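/- Let $\mathrm{twr}(0)=1$, $\mathrm{twr}(i+1)=2^{\mathrm{twr}(i)}$, and let $\mathrm{wwz}(0)=1$, $\mathrm{wwz}(i+1)=\mathrm{twr}(\mathrm{wwz}(i))$ (so that $\mathrm{wwz}(1)=2$). Let $p$ be a prime, and write $e_p(y)=\exp(2\pi i y/p)$. For a subspace $H\le\mathbb{F}_p^n$, a function $f:\mathbb{F}_p^n\to[0,1]$ and $\eta>0$, call $f$ *$\eta$-uniform* on the coset $H+c$ if $\bigl|\mathbb{E}_{x\in H+c}\bigl(f(x)-\mathbb{E}_{y\in H+c}f(y)\bigr)e_p(r^Tx)\bigr|\le\eta$ for all $r\in\mathbb{F}_p^n$. Call the partition $\mathcal{P}(H)$ of $\mathbb{F}_p^n$ into cosets of $H$ *$\eta$-regular for $f$* if the proportion of $c\in\mathbb{F}_p^n$ such that $f$ is not $\eta$-uniform on $H+c$ is at most $\eta$. The *energy* of $H$ with respect to $f$ is $\mathcal{E}(H)=\mathbb{E}_{x\in\mathbb{F}_p^n}\bigl(\mathbb{E}_{y\in H+x}f(y)\bigr)^2$. Given $\delta>0$ and $\varepsilon:\mathbb{N}\to(0,1)$,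 a pair of subspaces $W_2\le W_1\le\mathbb{F}_p^n$ is called *strongly regular for $f$* if $\mathcal{P}(W_2)$ is $\varepsilon(\operatorname{codim}W_1)$-regular for $f$ and $\mathcal{E}(W_2)-\mathcal{E}(W_1)\le\delta$. **Theorem A.** Let $p$ be a prime, $0<\delta\le 1/(20p)$, and let $\varepsilon:\mathbb{N}\to(0,1)$ satisfy $\varepsilon(d)\le\sqrt{\delta}/(80p^2(d+1))$ for all $d\ge 0$. Then for all sufficiently large $n$ (depending on $p,\delta,\varepsilon$) there is a function $f:\mathbb{F}_p^n\to[0,1]$ such that every pair $W_2\le W_1\le\mathbb{F}_p^n$ that is strongly regular for $f$ satisfies $$\operatorname{codim}W_1>\mathrm{wwz}\bigl(\lfloor\delta^{-1/2}/(10p)\rfloor\bigr)\quad\text{and}\quad\operatorname{codim}W_2>\mathrm{wwz}\bigl(\lfloor\delta^{-1/2}/(10p)\rfloor\bigr).$$ Consequently, if $C^{(1)},C^{(2)}\in\mathbb{N}$ are any constants such that for every $n$, every $f:\mathbb{F}_p^n\to[0,1]$ admits a strongly regular pair $W_2\le W_1\le\mathbb{F}_p^n$ with $\operatorname{codim}W_1\le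 C^{(1)}$ and $\operatorname{codim}W_2\le C^{(2)}$ (that is, $C^{(1)}=C^{(1)}_{\mathrm{sarl}}(p,\delta,\varepsilon)$ and $C^{(2)}=C^{(2)}_{\mathrm{sarl}}(p,\delta,\varepsilon)$ are admissible constants in the strong arithmetic regularity lemma), then $C^{(1)}>\mathrm{wwz}\bigl(\lfloor\delta^{-1/2}/(10p)\rfloor\bigr)$. -/

import Mathlib

open scoped BigOperators

namespace StrongReg

/-- The tower function: `twr 0 = 1`, `twr (i + 1) = 2 ^ twr i`. -/
def twr : ℕ → ℕ
  | 0 => 1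
  | i + 1 => 2 ^ twr i

/-- The wowzer function: `wwz (i + 1) = twr (wwz i)` and `wwz 1 = 2`. The value `wwz 0 = 1` is the
one for which the recursion gives `wwz 1 = twr 1 = 2`. -/
def wwz : ℕ → ℕ
  | 0 => 1
  | i + 1 => twr (wwz i)

/-- The value at `1` from which the wowzer function is usually started. -/
theorem wwz_one : wwz 1 = 2 := rfl

/-- The vector space `𝔽_p ^ n`. -/
abbrev Vec (p n : ℕ) : Type := Fin n → ZMod p

section

variable {p n : ℕ} [Fact p.Prime]

open Classical in
/-- The coset `H + c`, as a finite set of vectors. -/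
noncomputable def coset (H : Submodule (ZMod p) (Vec p n)) (c : Vec p n) : Finset (Vec p n) :=
  Finset.univ.filter (fun x => x - c ∈ H)

/-- The codimension of a subspace of `𝔽_p ^ n`. -/
noncomputable def codim (H : Submodule (ZMod p) (Vec p n)) : ℕ :=
  Module.finrank (ZMod p) (Vec p n ⧸ H)

/-- The Fourier transform of `F` on `H + c` at `r`: the average of `F x * e_p (rᵀ x)` over
`x ∈ H + c`, where `e_p y = exp (2 π i y / p)` (this is `ZMod.stdAddChar`). -/
noncomputable def fourierOn (H : Submodule (ZMod p) (Vec p n)) (c : Vec p n)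
    (F : Vec p n → ℂ) (r : Vec p n) : ℂ :=
  Finset.expect (coset H c) (fun x => F x * ZMod.stdAddChar (r ⬝ᵥ x))

/-- `f` is `ε`-uniform on `H + c`: after subtracting the mean of `f` on `H + c`, all Fourier
coefficients on `H + c` have absolute value at most `ε`. -/
def IsUniformOn (f : Vec p n → ℂ) (H : Submodule (ZMod p) (Vec p n)) (c : Vec p n) (ε : ℝ) :
    Prop :=
  ∀ r : Vec p n, ‖fourierOn H c (fun x => f x - Finset.expect (coset H c) f) r‖ ≤ ε

open Classical in
/-- The partition of `𝔽_p ^ n` into cosets of `H` is `ε`-regular for `f`: the proportion of those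
`c` for which `f` is not `ε`-uniform on `H + c` is at most `ε`. -/
def IsRegularPartition (f : Vec p n → ℝ) (H : Submodule (ZMod p) (Vec p n)) (ε : ℝ) : Prop :=
  ((Finset.univ.filter
      (fun c : Vec p n => ¬ IsUniformOn (fun x => (f x : ℂ)) H c ε)).card : ℝ)
    ≤ ε * (Fintype.card (Vec p n) : ℝ)

/-- The conditional expectation of `f` on the partition into cosets of `H`: the density of `f` on
the coset of `H` containing `x`. -/
noncomputable def cosetDensity (f : Vec p n → ℝ) (H : Submodule (ZMod p) (Vec p n))
    (x : Vec p n) : ℝ :=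
  Finset.expect (coset H x) f

/-- The energy of `H` with respect to `f`: the squared `L²` norm (with respect to the uniform
probability measure on `𝔽_p ^ n`) of the density function of `f` on cosets of `H`. -/
noncomputable def energy (f : Vec p n → ℝ) (H : Submodule (ZMod p) (Vec p n)) : ℝ :=
  Finset.expect Finset.univ (fun x => cosetDensity f H x ^ 2)

/-- The pair `W₂ ≤ W₁` is as in the strong arithmetic regularity lemma for `f`: the partition into
cosets of `W₂` is `ε (codim W₁)`-regular for `f`, and the energies differ by at most `δ`. -/
def IsStrongRegularPair (f : Vec p n → ℝ) (δ : ℝ) (ε : ℕ → ℝ)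
    (W₁ W₂ : Submodule (ZMod p) (Vec p n)) : Prop :=
  W₂ ≤ W₁ ∧ IsRegularPartition f W₂ (ε (codim W₁)) ∧ energy f W₂ - energy f W₁ ≤ δ

end

/-- `C₁` and `C₂` are admissible constants `C⁽¹⁾(p, δ, ε)` and `C⁽²⁾(p, δ, ε)` in the strong
arithmetic regularity lemma: in every dimension `n`, every function `f : 𝔽_p ^ n → [0, 1]` has a
pair of nested subspaces as above with codimensions at most `C₁` and `C₂`. -/
def AdmissibleConstants (p : ℕ) [Fact p.Prime] (δ : ℝ) (ε : ℕ → ℝ) (C₁ C₂ : ℕ) : Prop :=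
  ∀ (n : ℕ) (f : Vec p n → ℝ), (∀ x, f x ∈ Set.Icc (0 : ℝ) 1) →
    ∃ W₁ W₂ : Submodule (ZMod p) (Vec p n),
      IsStrongRegularPair f δ ε W₁ W₂ ∧ codim W₁ ≤ C₁ ∧ codim W₂ ≤ C₂

end StrongReg

/-! The function is a weighted sum of layers, layer `i` being the indicator of `ξ i x ⬝ᵥ x = 0`.
Here `ξ i x` lives on the `i`-th block of coordinates and is determined by the coordinates of `x` in
earlier blocks. The map sending a vector `v` of the block to all the values `ξ i x ⬝ᵥ v` is a linear
code of relative distance at least `1 / 4`. Such codes exist with block dimension exponential in the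
total earlier dimension, so the blocks grow like a tower.

Two facts drive the bound. If `W ≤ H i` is not inside `H (i + 1)`, layer `i` gives large Fourier
coefficients on many cosets of `W`. A sufficiently regular `W` must therefore descend into `H (i +
1)` (`le_of_isRegularPartition`). If `W₂ ≤ H (i + 1)` but `codim W₁` is below the dimension of block
`i`, then `W₁` contains a nonzero vector of that block and averages over much of the layer, which
costs energy of order `w i ^ 2 / p` (`energy_gap`).

The layers form `L` levels, with `L` of order at most `δ ^ (-1 / 2)`. Level `l` has `8 + wwz l`
light layers, followed by a heavy one whose energy cost exceeds `δ`. Once `wwz l ≤ codim W₁ + 1`,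
the parameter `ε (codim W₁)` is small enough to force `W₂` through the whole level. The light layers
raise the heavy block's dimension above `twr (wwz l) = wwz (l + 1)`, so the energy condition forces
`codim W₁ > wwz (l + 1)`. Induction on `l` finishes (`wwz_lt_codim_of_strongRegularPair`). -/

namespace StrongReg

/-! ### Averages over cosets and energy increments. -/

section CosetAverages

variable {p n : ℕ} [Fact p.Prime] {R : Type*} [Field R] [CharZero R]

theorem mem_coset {H : Submodule (ZMod p) (Vec p n)} {c x : Vec p n} :
    x ∈ coset H c ↔ x - c ∈ H := by
  simp [coset]

theorem coset_add_mem {H : Submodule (ZMod p) (Vec p n)} (c : Vec p n) {h : Vec p n}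
    (hh : h ∈ H) : coset H (c + h) = coset H c := by
  ext x
  rw [mem_coset, mem_coset, ← sub_sub, Submodule.sub_mem_iff_left _ hh]

theorem self_mem_coset (H : Submodule (ZMod p) (Vec p n)) (c : Vec p n) : c ∈ coset H c := by
  simp [mem_coset]

open Classical in
theorem expect_coset (H : Submodule (ZMod p) (Vec p n)) (c : Vec p n) (F : Vec p n → R) :
    Finset.expect (coset H c) F = (∑ h : H, F (c + h)) / Fintype.card H := by
  have key : coset H c = Finset.univ.image (fun h : H => c + (h : Vec p n)) := by
    ext x
    simp only [mem_coset, Finset.mem_image, Finset.mem_univ, true_and]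
    constructor
    · intro hx
      exact ⟨⟨x - c, hx⟩, by simp⟩
    · rintro ⟨h, rfl⟩
      simp
  have inj : Function.Injective (fun h : H => c + (h : Vec p n)) := fun a b hab =>
    Subtype.ext (add_left_cancel hab)
  rw [Finset.expect_eq_sum_div_card, key, Finset.card_image_of_injective _ inj,
    Finset.sum_image (fun a _ b _ hab => inj hab), Finset.card_univ]

theorem sum_expect_coset (H : Submodule (ZMod p) (Vec p n)) (F : Vec p n → R) :
    ∑ c, Finset.expect (coset H c) F = ∑ x, F x := by
  classical
  simp_rw [expect_coset]
  rw [← Finset.sum_div, Finset.sum_comm]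
  have : ∀ h : H, ∑ c, F (c + h) = ∑ x, F x := fun h =>
    Fintype.sum_equiv (Equiv.addRight (h : Vec p n)) _ _ (fun _ => rfl)
  simp_rw [this]
  rw [Finset.sum_const, nsmul_eq_mul, Finset.card_univ]
  exact mul_div_cancel_left₀ _ (by exact_mod_cast Fintype.card_ne_zero)

theorem expect_coset_of_invariant {H : Submodule (ZMod p) (Vec p n)} {F : Vec p n → R}
    (hF : ∀ x, ∀ h ∈ H, F (x + h) = F x) (c : Vec p n) : Finset.expect (coset H c) F = F c := by
  classical
  have : ∀ h : H, F (c + h) = F c := fun h => hF c h h.2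
  simp_rw [expect_coset, this]
  rw [Finset.sum_const, nsmul_eq_mul, Finset.card_univ]
  exact mul_div_cancel_left₀ _ (by exact_mod_cast Fintype.card_ne_zero)

/-- Conditional expectation is self-adjoint. -/
theorem sum_expect_coset_mul (H : Submodule (ZMod p) (Vec p n)) (F G : Vec p n → R) :
    ∑ x, Finset.expect (coset H x) F * G x = ∑ x, F x * Finset.expect (coset H x) G := by
  classical
  simp_rw [expect_coset, div_mul_eq_mul_div, mul_div_assoc', Finset.sum_mul, Finset.mul_sum]
  rw [← Finset.sum_div, ← Finset.sum_div, Finset.sum_comm,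
    Finset.sum_comm (s := Finset.univ (α := Vec p n))]
  congr 1
  refine Fintype.sum_equiv (Equiv.neg H) _ _ (fun h => ?_)
  refine Fintype.sum_equiv (Equiv.addRight (h : Vec p n)) _ _ (fun x => ?_)
  simp

/-- If the sum of `F` along every line in direction `v ∈ H` vanishes, so does its average on every
coset of `H`. -/
theorem expect_coset_eq_zero {H : Submodule (ZMod p) (Vec p n)} {F : Vec p n → R} {v : Vec p n}
    (hv : v ∈ H) (hF : ∀ x, ∑ t : ZMod p, F (x + t • v) = 0) (c : Vec p n) :
    Finset.expect (coset H c) F = 0 := by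
  classical
  have shift : ∀ t : ZMod p, ∑ h : H, F (c + h) = ∑ h : H, F (c + h + t • v) := fun t =>
    (Fintype.sum_equiv (Equiv.addRight (t • (⟨v, hv⟩ : H))) _ _ (fun h => by simp [add_assoc])).symm
  have hp : ((Fintype.card (ZMod p) : ℕ) : R) ≠ 0 := by exact_mod_cast Fintype.card_ne_zero
  have : ((Fintype.card (ZMod p) : ℕ) : R) * ∑ h : H, F (c + h) = 0 := by
    rw [← nsmul_eq_mul, ← Finset.card_univ, ← Finset.sum_const,
      Finset.sum_congr rfl (fun t _ => shift t), Finset.sum_comm]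
    exact Finset.sum_eq_zero (fun h _ => hF _)
  rw [expect_coset, (mul_eq_zero.mp this).resolve_left hp, zero_div]

/-- Pythagoras: the two densities are nested orthogonal projections of `f`. -/
theorem energy_sub_energy (f : Vec p n → ℝ) {W₁ W₂ : Submodule (ZMod p) (Vec p n)} (h : W₂ ≤ W₁) :
    (Fintype.card (Vec p n) : ℝ) * (energy f W₂ - energy f W₁) =
      ∑ x, (cosetDensity f W₂ x - cosetDensity f W₁ x) ^ 2 := by
  have inv₁ : ∀ x, ∀ h ∈ W₁, cosetDensity f W₁ (x + h) = cosetDensity f W₁ x := fun x h hh => by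
    simp only [cosetDensity, coset_add_mem x hh]
  have cross : ∀ W ≤ W₁, ∑ x, cosetDensity f W x * cosetDensity f W₁ x =
      ∑ x, f x * cosetDensity f W₁ x := fun W hW => by
    unfold cosetDensity
    rw [sum_expect_coset_mul W f]
    refine Finset.sum_congr rfl (fun x _ => ?_)
    congr 1
    exact expect_coset_of_invariant (F := cosetDensity f W₁) (fun x h hh => inv₁ x h (hW hh)) x
  have hc : (Fintype.card (Vec p n) : ℝ) ≠ 0 := by exact_mod_cast Fintype.card_ne_zero
  have e : ∀ W, (Fintype.card (Vec p n) : ℝ) * energy f W = ∑ x, cosetDensity f W x ^ 2 := fun W => by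
    rw [energy, Finset.expect_eq_sum_div_card, Finset.card_univ, mul_div_cancel₀ _ hc]
  have h2 := cross W₂ h
  have h1 := cross W₁ le_rfl
  rw [mul_sub, e, e]
  have : ∀ x, (cosetDensity f W₂ x - cosetDensity f W₁ x) ^ 2 = cosetDensity f W₂ x ^ 2
      - 2 * (cosetDensity f W₂ x * cosetDensity f W₁ x) + cosetDensity f W₁ x ^ 2 := fun x => by ring
  simp_rw [this]
  rw [Finset.sum_add_distrib, Finset.sum_sub_distrib, ← Finset.mul_sum, h2, ← h1]
  simp_rw [← pow_two]
  ring

/-- The energy increment from `W₁` to `W₂` dominates the correlation of `f` with any function that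
is constant on cosets of `W₂` and has mean zero on cosets of `W₁`. -/
theorem sq_sum_mul_le_energy_sub (f φ : Vec p n → ℝ) {W₁ W₂ : Submodule (ZMod p) (Vec p n)}
    (h : W₂ ≤ W₁) (h₂ : ∀ x, ∀ h ∈ W₂, φ (x + h) = φ x)
    (h₁ : ∀ x, Finset.expect (coset W₁ x) φ = 0) :
    (∑ x, f x * φ x) ^ 2 ≤
      (Fintype.card (Vec p n) : ℝ) * (energy f W₂ - energy f W₁) * ∑ x, φ x ^ 2 := by
  rw [energy_sub_energy f h]
  have : ∑ x, f x * φ x = ∑ x, (cosetDensity f W₂ x - cosetDensity f W₁ x) * φ x := by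
    simp_rw [sub_mul]
    unfold cosetDensity
    rw [Finset.sum_sub_distrib, sum_expect_coset_mul W₂, sum_expect_coset_mul W₁]
    simp_rw [h₁, expect_coset_of_invariant h₂]
    simp
  rw [this]
  exact Finset.sum_mul_sq_le_sq_mul_sq _ _ _

end CosetAverages

/-! ### Layer systems: correlation, energy gap, and refinement forced by regularity. -/

/-- A decreasing chain of subspaces `H i`, together with directions `ξ i x` which depend only on the
coset of `H i` containing `x`, vanish on `H (i + 1)` but not on `H i`, and such that every vector of
`H i` outside `H (i + 1)` is non-orthogonal to `ξ i x` for at least a quarter of all `x`. -/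
structure LayerSystem (p n M : ℕ) [Fact p.Prime] where
  H : ℕ → Submodule (ZMod p) (Vec p n)
  anti : Antitone H
  top : H 0 = ⊤
  ξ : ℕ → Vec p n → Vec p n
  dim : ℕ → ℕ
  invariant : ∀ i < M, ∀ x, ∀ h ∈ H i, ξ i (x + h) = ξ i x
  nonzero : ∀ i < M, ∀ x, ∃ h ∈ H i, ξ i x ⬝ᵥ h ≠ 0
  perp : ∀ i < M, ∀ x, ∀ h ∈ H (i + 1), ξ i x ⬝ᵥ h = 0
  spread : ∀ i < M, ∀ v ∈ H i, v ∉ H (i + 1) →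
    Fintype.card (Vec p n) ≤ 4 * (Finset.univ.filter (fun x => ξ i x ⬝ᵥ v ≠ 0)).card
  block : ∀ i < M, ∃ ι : Vec p (dim i) →ₗ[ZMod p] Vec p n,
    ∀ y, y ≠ 0 → ι y ∈ H i ∧ ι y ∉ H (i + 1)

namespace LayerSystem

variable {p n M : ℕ} [Fact p.Prime] (S : LayerSystem p n M)
  {R : Type*} [Field R]

/-- The weighted sum of the indicator functions of the sets `{x | ξ i x ⬝ᵥ x = 0}`. -/
def layerSum (w : ℕ → R) (x : Vec p n) : R :=
  ∑ j ∈ Finset.range M, w j * if S.ξ j x ⬝ᵥ x = 0 then 1 else 0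

/-- The points at which the direction of layer `i` is not orthogonal to `v`. -/
def good (i : ℕ) (v : Vec p n) : Finset (Vec p n) :=
  Finset.univ.filter (fun x => S.ξ i x ⬝ᵥ v ≠ 0)

theorem mem_good {i : ℕ} {v x : Vec p n} : x ∈ S.good i v ↔ S.ξ i x ⬝ᵥ v ≠ 0 := by
  simp [good]

variable {S}

theorem dotProduct_add {i j : ℕ} (hij : i < j) (hi : i < M) (x : Vec p n) {h : Vec p n}
    (hh : h ∈ S.H j) : S.ξ i (x + h) ⬝ᵥ (x + h) = S.ξ i x ⬝ᵥ x := by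
  rw [S.invariant i hi x h (S.anti hij.le hh), _root_.dotProduct_add,
    S.perp i hi x h (S.anti (Nat.succ_le_of_lt hij) hh), add_zero]

theorem mem_good_add {i : ℕ} (hi : i < M) {v x h : Vec p n} (hh : h ∈ S.H i) :
    x + h ∈ S.good i v ↔ x ∈ S.good i v := by
  rw [mem_good, mem_good, S.invariant i hi x h hh]

/-- Shifting `x` inside its coset of `H i` leaves `ξ i x` and `G x` fixed but moves `ξ i x ⬝ᵥ x`
through all residues. -/
theorem equidistribution {i : ℕ} (hi : i < M) (G : Vec p n → R)
    (hG : ∀ x, ∀ h ∈ S.H i, G (x + h) = G x) (Ψ : ZMod p → R) :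
    (p : R) * ∑ x, G x * Ψ (S.ξ i x ⬝ᵥ x) = (∑ a, Ψ a) * ∑ x, G x := by
  -- The shift vector is a function of the value `ξ i x`, not of `x`; the shift preserves this value
  -- and is thus invertible.
  have ex : ∀ z : Vec p n, ∃ h, (∃ x, S.ξ i x = z) → h ∈ S.H i ∧ z ⬝ᵥ h = 1 := fun z => by
    by_cases hz : ∃ x, S.ξ i x = z
    · obtain ⟨x, rfl⟩ := hz
      obtain ⟨h, hh, hne⟩ := S.nonzero i hi x
      refine ⟨(S.ξ i x ⬝ᵥ h)⁻¹ • h, fun _ => ⟨Submodule.smul_mem _ _ hh, ?_⟩⟩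
      rw [dotProduct_smul, smul_eq_mul, inv_mul_cancel₀ hne]
    · exact ⟨0, fun h => (hz h).elim⟩
  choose η hη using ex
  have hmem : ∀ x (t : ZMod p), t • η (S.ξ i x) ∈ S.H i := fun x t =>
    Submodule.smul_mem _ _ (hη _ ⟨x, rfl⟩).1
  have shift : ∀ t : ZMod p, ∑ x, G x * Ψ (S.ξ i x ⬝ᵥ x) =
      ∑ x, G x * Ψ (S.ξ i x ⬝ᵥ x + t) := fun t => by
    let e : Vec p n ≃ Vec p n :=
      { toFun := fun x => x + t • η (S.ξ i x)
        invFun := fun x => x + (-t) • η (S.ξ i x)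
        left_inv := fun x => by
          simp only [S.invariant i hi x _ (hmem x t)]
          simp
        right_inv := fun x => by
          simp only [S.invariant i hi x _ (hmem x (-t))]
          simp }
    refine (Fintype.sum_equiv e _ _ (fun x => ?_)).symm
    have h1 : e x = x + t • η (S.ξ i x) := rfl
    rw [h1, hG x _ (hmem x t), S.invariant i hi x _ (hmem x t), _root_.dotProduct_add,
      dotProduct_smul, (hη _ ⟨x, rfl⟩).2, smul_eq_mul, mul_one]
  calc (p : R) * ∑ x, G x * Ψ (S.ξ i x ⬝ᵥ x)
      = ∑ t : ZMod p, ∑ x, G x * Ψ (S.ξ i x ⬝ᵥ x + t) := by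
        rw [← Finset.sum_congr rfl (fun t _ => shift t), Finset.sum_const, Finset.card_univ,
          ZMod.card, nsmul_eq_mul]
    _ = ∑ x, G x * ∑ a, Ψ a := by
        rw [Finset.sum_comm]
        refine Finset.sum_congr rfl (fun x _ => ?_)
        rw [← Finset.mul_sum]
        congr 1
        exact Fintype.sum_equiv (Equiv.addLeft _) _ _ (fun _ => rfl)
    _ = _ := by rw [← Finset.sum_mul, mul_comm]

theorem p_ne_zero [CharZero R] : (p : R) ≠ 0 := by exact_mod_cast (Fact.out : p.Prime).ne_zero

theorem sum_eq_zero [CharZero R] {i : ℕ} (hi : i < M) (G : Vec p n → R)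
    (hG : ∀ x, ∀ h ∈ S.H i, G (x + h) = G x) (Ψ : ZMod p → R) (hΨ : ∑ a, Ψ a = 0) :
    ∑ x, G x * Ψ (S.ξ i x ⬝ᵥ x) = 0 := by
  have := equidistribution hi G hG Ψ
  rw [hΨ, zero_mul] at this
  exact (mul_eq_zero.mp this).resolve_left p_ne_zero

/-- Only layer `i` of a layer sum correlates with mean zero functions of `ξ i x ⬝ᵥ x`. -/
theorem correlation [CharZero R] {i : ℕ} (hi : i < M) (w : ℕ → R) (v : Vec p n) (Ψ : ZMod p → R)
    (hΨ : ∑ a, Ψ a = 0) :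
    (p : R) * ∑ x, S.layerSum w x * (if x ∈ S.good i v then Ψ (S.ξ i x ⬝ᵥ x) else 0) =
      Ψ 0 * w i * (S.good i v).card := by
  have hgood : ∀ j, i ≤ j → ∀ x, ∀ h ∈ S.H j,
      (if x + h ∈ S.good i v then (1 : R) else 0) = if x ∈ S.good i v then 1 else 0 :=
    fun j hij x h hh => by simp only [mem_good_add hi (S.anti hij hh)]
  have card : ∑ x, (if x ∈ S.good i v then (1 : R) else 0) = (S.good i v).card := by simp
  have main : ∀ j ∈ Finset.range M, ∑ x, (w j * if S.ξ j x ⬝ᵥ x = 0 then 1 else 0) *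
      (if x ∈ S.good i v then Ψ (S.ξ i x ⬝ᵥ x) else 0) =
      if j = i then Ψ 0 * w i * (S.good i v).card / p else 0 := by
    intro j hj
    rw [Finset.mem_range] at hj
    -- Earlier layers are constant on cosets of `H i`, so the mean zero `Ψ` kills them. For a later
    -- layer, the test function is constant on cosets of `H j`; the layer then only contributes its
    -- average times the zero sum of the test function.
    rcases lt_trichotomy j i with hji | rfl | hij
    · rw [if_neg hji.ne]
      have := sum_eq_zero (S := S) hi (fun x => (w j * if S.ξ j x ⬝ᵥ x = 0 then 1 else 0) *
        (if x ∈ S.good i v then (1 : R) else 0))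
        (fun x h hh => by simp only [hgood i le_rfl x h hh, dotProduct_add hji hj x hh]) Ψ hΨ
      refine (Finset.sum_congr rfl (fun x _ => ?_)).trans this
      split_ifs <;> simp
    · rw [if_pos rfl, eq_div_iff p_ne_zero, mul_comm]
      have := equidistribution (S := S) hi (fun x => w j * if x ∈ S.good j v then (1 : R) else 0)
        (fun x h hh => by simp only [hgood j le_rfl x h hh]) (fun a => if a = 0 then Ψ a else 0)
      rw [← Finset.mul_sum, card, Finset.sum_ite_eq' Finset.univ (0 : ZMod p),
        if_pos (Finset.mem_univ _), ← mul_assoc] at this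
      rw [← this]
      congr 1
      refine Finset.sum_congr rfl (fun x _ => ?_)
      split_ifs <;> simp
    · rw [if_neg hij.ne']
      have h0 : ∑ x, (if x ∈ S.good i v then (1 : R) else 0) * Ψ (S.ξ i x ⬝ᵥ x) = 0 :=
        sum_eq_zero hi _ (hgood i le_rfl) Ψ hΨ
      have := equidistribution (S := S) hj (fun x => (if x ∈ S.good i v then (1 : R) else 0) *
        Ψ (S.ξ i x ⬝ᵥ x)) (fun x h hh => by simp only [hgood j hij.le x h hh,
          dotProduct_add hij hi x hh]) (fun a => if a = 0 then w j else 0)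
      rw [h0, mul_zero] at this
      refine (Finset.sum_congr rfl (fun x _ => ?_)).trans
        ((mul_eq_zero.mp this).resolve_left p_ne_zero)
      split_ifs <;> simp [mul_comm]
  unfold layerSum
  simp_rw [Finset.sum_mul]
  rw [Finset.sum_comm, Finset.sum_congr rfl main, Finset.sum_ite_eq' (Finset.range M),
    if_pos (Finset.mem_range.mpr hi), mul_div_cancel₀ _ p_ne_zero]

theorem le_card_good {i : ℕ} (hi : i < M) {v : Vec p n} (hv : v ∈ S.H i) (hv' : v ∉ S.H (i + 1)) :
    (Fintype.card (Vec p n) : ℝ) / 4 ≤ (S.good i v).card := by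
  have : (Fintype.card (Vec p n) : ℝ) ≤ 4 * (S.good i v).card := by
    exact_mod_cast S.spread i hi v hv hv'
  linarith

theorem layerSum_mem_Icc (w : ℕ → ℝ) (hw : ∀ i, 0 ≤ w i) (hs : ∑ i ∈ Finset.range M, w i ≤ 1)
    (x : Vec p n) : S.layerSum w x ∈ Set.Icc (0 : ℝ) 1 := by
  refine ⟨Finset.sum_nonneg fun j _ => mul_nonneg (hw j) (by split_ifs <;> simp), le_trans ?_ hs⟩
  refine Finset.sum_le_sum fun j _ => ?_
  split_ifs <;> simp [hw j]

/-- A vector of `W` lying in `H i` but not in `H (i + 1)`, for `W` of small codimension. -/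
theorem exists_mem_of_codim_lt {i : ℕ} (hi : i < M) {W : Submodule (ZMod p) (Vec p n)}
    (hW : codim W < S.dim i) : ∃ v ∈ W, v ∈ S.H i ∧ v ∉ S.H (i + 1) := by
  obtain ⟨ι, hι⟩ := S.block i hi
  have hk : LinearMap.ker (W.mkQ.comp ι) ≠ ⊥ :=
    LinearMap.ker_ne_bot_of_finrank_lt (by simpa [codim] using hW)
  obtain ⟨y, hy, hy0⟩ := Submodule.exists_mem_ne_zero_of_ne_bot hk
  exact ⟨ι y, by simpa using hy, hι y hy0⟩

/-- Cauchy–Schwarz against the centred indicator of layer `i`, restricted to the points whose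
direction detects a vector `v` of `W₁`. -/
theorem energy_gap {i : ℕ} (hi : i < M) (w : ℕ → ℝ) {W₁ W₂ : Submodule (ZMod p) (Vec p n)}
    (h21 : W₂ ≤ W₁) (h2 : W₂ ≤ S.H (i + 1)) (hW : codim W₁ < S.dim i) :
    w i ^ 2 * (1 - 1 / p) / (4 * p) ≤
      energy (S.layerSum w) W₂ - energy (S.layerSum w) W₁ := by
  obtain ⟨v, hv1, hvi, hvi'⟩ := exists_mem_of_codim_lt hi hW
  have hp2 : (2 : ℝ) ≤ p := by exact_mod_cast (Fact.out : p.Prime).two_le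
  have hp0 : (p : ℝ) ≠ 0 := by positivity
  set Ψ : ZMod p → ℝ := fun a => (if a = 0 then 1 else 0) - 1 / p with hΨdef
  have hΨ : ∑ a, Ψ a = 0 := by
    simp only [hΨdef, Finset.sum_sub_distrib]
    simp [hp0]
  have hΨ2 : ∑ a, Ψ a ^ 2 = 1 - 1 / p := by
    have : ∀ a, Ψ a ^ 2 = (if a = 0 then 1 else 0) * (1 - 2 / p) + 1 / p ^ 2 := fun a => by
      simp only [hΨdef]
      split_ifs <;> ring
    simp_rw [this]
    rw [Finset.sum_add_distrib, ← Finset.sum_mul]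
    simp
    field_simp
    ring
  have hΨ0 : Ψ 0 = 1 - 1 / p := by simp [hΨdef]
  set φ : Vec p n → ℝ := fun x => if x ∈ S.good i v then Ψ (S.ξ i x ⬝ᵥ x) else 0 with hφdef
  have hφ2 : (p : ℝ) * ∑ x, φ x ^ 2 = (1 - 1 / p) * (S.good i v).card := by
    have := equidistribution (S := S) hi (fun x => if x ∈ S.good i v then (1 : ℝ) else 0)
      (fun x h hh => by simp only [mem_good_add hi hh]) (fun a => Ψ a ^ 2)
    rw [hΨ2, Finset.sum_boole, Finset.filter_mem_eq_inter, Finset.univ_inter] at this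
    rw [← this]
    congr 1
    refine Finset.sum_congr rfl (fun x _ => ?_)
    simp only [hφdef]
    split_ifs <;> simp
  have hcor := correlation (S := S) hi w v Ψ hΨ
  rw [hΨ0] at hcor
  have inv : ∀ x, ∀ h ∈ W₂, φ (x + h) = φ x := fun x h hh => by
    have hh' := h2 hh
    simp only [hφdef, mem_good_add hi (S.anti i.le_succ hh'), dotProduct_add (Nat.lt_succ_self i) hi x hh']
  -- Along a line in direction `v`, the residue `ξ i x ⬝ᵥ x` takes every value once.
  have mean : ∀ x, Finset.expect (coset W₁ x) φ = 0 := by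
    refine expect_coset_eq_zero hv1 (fun x => ?_)
    have hx : ∀ t : ZMod p, φ (x + t • v) =
        if x ∈ S.good i v then Ψ (S.ξ i x ⬝ᵥ x + t * (S.ξ i x ⬝ᵥ v)) else 0 := fun t => by
      have ht := Submodule.smul_mem (S.H i) t hvi
      simp only [hφdef, mem_good_add hi ht, S.invariant i hi x _ ht, _root_.dotProduct_add,
        dotProduct_smul, smul_eq_mul]
    simp_rw [hx]
    split_ifs with hg
    · rw [mem_good] at hg
      rw [← hΨ]
      exact Fintype.sum_equiv ((Equiv.mulRight₀ _ hg).trans (Equiv.addLeft _)) _ _ (fun _ => rfl)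
    · simp
  have main := sq_sum_mul_le_energy_sub (S.layerSum w) φ h21 inv mean
  have hg := le_card_good (S := S) hi hvi hvi'
  set N : ℝ := (Fintype.card (Vec p n) : ℝ)
  have hN : 0 < N := Nat.cast_pos.mpr Fintype.card_pos
  set g : ℝ := ((S.good i v).card : ℝ)
  set Δ := energy (S.layerSum w) W₂ - energy (S.layerSum w) W₁
  have hq : 0 < 1 - 1 / (p : ℝ) := by
    have : 1 / (p : ℝ) ≤ 1 / 2 := by gcongr
    linarith
  have e1 : ∑ x, S.layerSum w x * φ x = (1 - 1 / p) * w i * g / p := by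
    rw [eq_div_iff hp0, mul_comm]; exact hcor
  have e2 : ∑ x, φ x ^ 2 = (1 - 1 / p) * g / p := by
    rw [eq_div_iff hp0, mul_comm]; exact hφ2
  rw [e1, e2] at main
  have hg0 : 0 < g := lt_of_lt_of_le (by positivity) hg
  have hc : 0 < (1 - 1 / (p : ℝ)) * g / p := by positivity
  have m2 : w i ^ 2 * ((1 - 1 / (p : ℝ)) * g / p) ≤ N * Δ := by
    refine le_of_mul_le_mul_right ?_ hc
    calc _ = ((1 - 1 / (p : ℝ)) * w i * g / p) ^ 2 := by ring
      _ ≤ _ := main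
  refine le_of_mul_le_mul_left ?_ hN
  refine le_trans ?_ m2
  calc N * (w i ^ 2 * (1 - 1 / p) / (4 * p)) = w i ^ 2 * ((1 - 1 / (p : ℝ)) * (N / 4) / p) := by
        field_simp
    _ ≤ _ := by gcongr

theorem sum_stdAddChar_eq_zero : ∑ a : ZMod p, ZMod.stdAddChar a = (0 : ℂ) := by
  refine AddChar.sum_eq_zero_of_ne_one fun h => ?_
  have := ZMod.isPrimitive_stdAddChar p (one_ne_zero (α := ZMod p))
  rw [AddChar.mulShift_one] at this
  exact this h

theorem norm_fourierOn_le_one {f : Vec p n → ℝ} (hf : ∀ x, f x ∈ Set.Icc (0 : ℝ) 1)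
    (W : Submodule (ZMod p) (Vec p n)) (c r : Vec p n) :
    ‖fourierOn W c (fun x => (f x : ℂ) - Finset.expect (coset W c) (fun x => (f x : ℂ))) r‖ ≤ 1 := by
  have hne : (coset W c).Nonempty := ⟨c, self_mem_coset W c⟩
  have hm : Finset.expect (coset W c) (fun x => (f x : ℂ)) =
      ((Finset.expect (coset W c) f : ℝ) : ℂ) := by
    rw [Finset.expect_eq_sum_div_card, Finset.expect_eq_sum_div_card]
    push_cast
    rfl
  have h0 : 0 ≤ Finset.expect (coset W c) f := Finset.expect_nonneg fun x _ => (hf x).1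
  have h1 : Finset.expect (coset W c) f ≤ 1 := Finset.expect_le hne fun x _ => (hf x).2
  unfold fourierOn
  rw [Finset.expect_eq_sum_div_card, norm_div, Complex.norm_natCast]
  have hc : (0 : ℝ) < (coset W c).card := Nat.cast_pos.mpr hne.card_pos
  rw [div_le_one hc]
  refine (norm_sum_le_of_le (n := fun _ => (1 : ℝ)) _ fun x _ => ?_).trans (by simp)
  beta_reduce
  rw [norm_mul, AddChar.norm_apply, mul_one, hm, ← Complex.ofReal_sub, Complex.norm_real,
    Real.norm_eq_abs, abs_le]
  constructor <;> linarith [(hf x).1, (hf x).2]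

/-- A regular partition into cosets of a subspace of `H i` must refine layer `i`, unless the weight
of the layer is small compared with the regularity parameter. -/
theorem le_of_isRegularPartition {i : ℕ} (hi : i < M) {w : ℕ → ℝ} (hw : 0 ≤ w i)
    (hf : ∀ x, S.layerSum w x ∈ Set.Icc (0 : ℝ) 1) {W : Submodule (ZMod p) (Vec p n)} {ε : ℝ}
    (hε : 0 ≤ ε) (hreg : IsRegularPartition (S.layerSum w) W ε) (hWi : W ≤ S.H i)
    (hlarge : 2 * ε < w i / (4 * p)) : W ≤ S.H (i + 1) := by
  classical
  by_contra hnot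
  obtain ⟨v, hv, hv'⟩ := SetLike.not_le_iff_exists.mp hnot
  have hp0 : 0 < (p : ℝ) := Nat.cast_pos.mpr (Fact.out : p.Prime).pos
  set f := S.layerSum w with hfdef
  set F : Vec p n → Vec p n → ℂ := fun c r =>
    fourierOn W c (fun x => (f x : ℂ) - Finset.expect (coset W c) (fun x => (f x : ℂ))) r with hF
  -- On good cosets the frequency is the layer's own direction; elsewhere frequency zero gives
  -- coefficient zero, as the mean is subtracted.
  set r : Vec p n → Vec p n := fun c => if c ∈ S.good i v then S.ξ i c else 0 with hr
  set Q : Vec p n → ℂ := fun x => S.layerSum (fun j => (w j : ℂ)) x *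
    (if x ∈ S.good i v then ZMod.stdAddChar (S.ξ i x ⬝ᵥ x) else 0) with hQ
  have hfC : ∀ x, S.layerSum (fun j => (w j : ℂ)) x = (f x : ℂ) := fun x => by
    simp only [hfdef, layerSum]
    push_cast
    refine Finset.sum_congr rfl fun j _ => ?_
    split_ifs <;> simp
  have hcoset : ∀ c, ∀ x ∈ coset W c, ∃ h ∈ S.H i, x = c + h := fun c x hx =>
    ⟨x - c, hWi (mem_coset.mp hx), by simp⟩
  have hFQ : ∀ c, F c (r c) = Finset.expect (coset W c) Q := by
    intro c
    by_cases hc : c ∈ S.good i v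
    -- The character is nontrivial on `W`, because `v` detects it, so subtracting the mean changes
    -- nothing.
    · have hchar : Finset.expect (coset W c) (fun x => ZMod.stdAddChar (S.ξ i c ⬝ᵥ x)) = (0 : ℂ) := by
        refine expect_coset_eq_zero hv (fun x => ?_) c
        rw [mem_good] at hc
        rw [← sum_stdAddChar_eq_zero (p := p)]
        refine Fintype.sum_equiv ((Equiv.mulRight₀ _ hc).trans (Equiv.addLeft (S.ξ i c ⬝ᵥ x))) _ _
          fun t => ?_
        simp [_root_.dotProduct_add, dotProduct_smul]
      simp only [hF, hr, if_pos hc, fourierOn, sub_mul]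
      rw [Finset.expect_sub_distrib, ← Finset.mul_expect, hchar, mul_zero, sub_zero]
      refine Finset.expect_congr rfl fun x hx => ?_
      obtain ⟨h, hh, rfl⟩ := hcoset c x hx
      simp only [mem_good_add hi hh, if_pos hc, hfC, S.invariant i hi c h hh]
    · have hQ0 : Finset.expect (coset W c) Q = 0 := by
        refine Finset.expect_eq_zero fun x hx => ?_
        obtain ⟨h, hh, rfl⟩ := hcoset c x hx
        simp only [mem_good_add hi hh, if_neg hc, mul_zero]
      rw [hQ0]
      simp only [hF, hr, if_neg hc, fourierOn, zero_dotProduct, AddChar.map_zero_eq_one, mul_one]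
      rw [Finset.expect_sub_distrib, Finset.expect_const ⟨c, self_mem_coset W c⟩, sub_self]
  have hsum : (p : ℂ) * ∑ c, F c (r c) = w i * (S.good i v).card := by
    simp_rw [hFQ]
    rw [sum_expect_coset, correlation hi _ v _ sum_stdAddChar_eq_zero]
    simp
  have hnorm : (p : ℝ) * ‖∑ c, F c (r c)‖ = w i * (S.good i v).card := by
    have := congrArg norm hsum
    rwa [norm_mul, norm_mul, Complex.norm_natCast, Complex.norm_natCast, Complex.norm_real,
      Real.norm_of_nonneg hw] at this
  set B := Finset.univ.filter
    (fun c : Vec p n => ¬ IsUniformOn (fun x => (f x : ℂ)) W c ε) with hB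
  have hBc : (B.card : ℝ) ≤ ε * (Fintype.card (Vec p n) : ℝ) := by
    have := hreg
    unfold IsRegularPartition at this
    convert this
  -- One `ε` comes from the uniform cosets, the other from the proportion of non-uniform ones, where
  -- the coefficient is at most `1`.
  have hbound : ‖∑ c, F c (r c)‖ ≤ 2 * ε * (Fintype.card (Vec p n) : ℝ) := by
    have h1 : ∀ c ∈ Finset.univ, ‖F c (r c)‖ ≤ ε + if c ∈ B then 1 else 0 := fun c _ => by
      by_cases hcB : c ∈ B
      · rw [if_pos hcB]
        have := norm_fourierOn_le_one hf W c (r c)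
        simp only [hF]
        linarith
      · rw [if_neg hcB, add_zero]
        have : IsUniformOn (fun x => (f x : ℂ)) W c ε := by simpa [hB] using hcB
        exact this (r c)
    refine (norm_sum_le_of_le _ h1).trans ?_
    rw [Finset.sum_add_distrib, Finset.sum_const, Finset.card_univ, nsmul_eq_mul,
      Finset.sum_boole, Finset.filter_mem_eq_inter, Finset.univ_inter]
    linarith
  have hg := le_card_good hi (hWi hv) hv'
  have hN : (0 : ℝ) < Fintype.card (Vec p n) := Nat.cast_pos.mpr Fintype.card_pos
  have h2 : w i * ((Fintype.card (Vec p n) : ℝ) / 4) ≤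
      p * (2 * ε * (Fintype.card (Vec p n) : ℝ)) := by
    calc _ ≤ w i * (S.good i v).card := by gcongr
      _ = p * ‖∑ c, F c (r c)‖ := hnorm.symm
      _ ≤ _ := by gcongr
  have h3 : w i / (4 * p) ≤ 2 * ε := by
    rw [div_le_iff₀ (by positivity)]
    refine le_of_mul_le_mul_right ?_ hN
    linarith
  linarith

end LayerSystem

/-! ### Linear codes of large distance. -/

section Codes

variable {p : ℕ} [Fact p.Prime]

theorem sum_dotProduct {k : ℕ} {v : Vec p k} (hv : v ≠ 0) (Ψ : ZMod p → ℝ) :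
    (p : ℝ) * ∑ y : Vec p k, Ψ (y ⬝ᵥ v) = (∑ a, Ψ a) * (p : ℝ) ^ k := by
  obtain ⟨b, hb⟩ := Function.ne_iff.mp hv
  have hb' : v b ≠ 0 := hb
  have shift : ∀ t : ZMod p, ∑ y : Vec p k, Ψ (y ⬝ᵥ v) = ∑ y : Vec p k, Ψ (y ⬝ᵥ v + t) := fun t =>
    (Fintype.sum_equiv (Equiv.addRight (Pi.single b (t * (v b)⁻¹))) _ _ fun y => by
      simp [_root_.add_dotProduct, hb']).symm
  calc (p : ℝ) * ∑ y : Vec p k, Ψ (y ⬝ᵥ v)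
      = ∑ t : ZMod p, ∑ y : Vec p k, Ψ (y ⬝ᵥ v + t) := by
        rw [← Finset.sum_congr rfl (fun t _ => shift t), Finset.sum_const, Finset.card_univ,
          ZMod.card, nsmul_eq_mul]
    _ = ∑ y : Vec p k, ∑ a, Ψ a := by
        rw [Finset.sum_comm]
        refine Finset.sum_congr rfl fun y _ => ?_
        exact Fintype.sum_equiv (Equiv.addLeft _) _ _ (fun _ => rfl)
    _ = _ := by
        rw [Finset.sum_const, Finset.card_univ, nsmul_eq_mul, mul_comm]
        simp [ZMod.card]

/-- A random linear code of small rate has relative distance at least `1 / 4`. -/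
theorem exists_code_of_lt (k : ℕ) {X : Type*} [Fintype X]
    (hk : p ^ k * 337 ^ Fintype.card X < 384 ^ Fintype.card X) :
    ∃ C : X → Vec p k, ∀ v, v ≠ 0 →
      Fintype.card X ≤ 4 * (Finset.univ.filter fun x => C x ⬝ᵥ v ≠ 0).card := by
  classical
  by_contra! hbad
  set N := Fintype.card X with hN
  have hp2 : (2 : ℝ) ≤ p := by exact_mod_cast (Fact.out : p.Prime).two_le
  -- Exponential moment with `81 / 256 = (3 / 4) ^ 4`: a codeword of weight below `N / 4` has
  -- product at least `(3 / 4) ^ N`. The mean of `Ψ` is at most `337 / 512`, its value at `p = 2`.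
  set Ψ : ZMod p → ℝ := fun a => if a ≠ 0 then 81 / 256 else 1 with hΨ
  have hΨ0 : ∀ a, 0 ≤ Ψ a := fun a => by simp only [hΨ]; split_ifs <;> norm_num
  have hsum : ∑ a, Ψ a = 1 + ((p : ℝ) - 1) * (81 / 256) := by
    have : ∀ a, Ψ a = 81 / 256 + if a = 0 then 175 / 256 else 0 := fun a => by
      simp only [hΨ]
      by_cases h : a = 0 <;> simp [h]
      norm_num
    simp_rw [this]
    rw [Finset.sum_add_distrib]
    simp [ZMod.card]
    ring
  have hdot : ∀ v : Vec p k, v ≠ 0 → ∑ y, Ψ (y ⬝ᵥ v) ≤ (p : ℝ) ^ k * (337 / 512) := fun v hv => by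
    have h1 := sum_dotProduct hv Ψ
    rw [hsum] at h1
    have hpk : (0 : ℝ) < (p : ℝ) ^ k := by positivity
    refine le_of_mul_le_mul_left (a := (p : ℝ)) ?_ (by positivity)
    rw [h1]
    nlinarith
  have hlow : ∀ C : X → Vec p k,
      (3 / 4 : ℝ) ^ N ≤ ∑ v ∈ Finset.univ.filter (fun v : Vec p k => v ≠ 0), ∏ x, Ψ (C x ⬝ᵥ v) := by
    intro C
    obtain ⟨v, hv, hlt⟩ := hbad C
    have hprod : ∏ x, Ψ (C x ⬝ᵥ v) =
        (81 / 256 : ℝ) ^ (Finset.univ.filter fun x => C x ⬝ᵥ v ≠ 0).card := by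
      simp only [hΨ]
      rw [Finset.prod_ite, Finset.prod_const, Finset.prod_const_one, mul_one]
    calc (3 / 4 : ℝ) ^ N
        ≤ (3 / 4 : ℝ) ^ (4 * (Finset.univ.filter fun x => C x ⬝ᵥ v ≠ 0).card) :=
          pow_le_pow_of_le_one (by norm_num) (by norm_num) hlt.le
      _ = ∏ x, Ψ (C x ⬝ᵥ v) := by
          rw [hprod, pow_mul]
          norm_num
      _ ≤ _ := Finset.single_le_sum
          (f := fun v => ∏ x, Ψ (C x ⬝ᵥ v)) (fun v _ => Finset.prod_nonneg fun x _ => hΨ0 _)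
          (by simpa using hv)
  have hup : ∑ C : X → Vec p k, ∑ v ∈ Finset.univ.filter (fun v : Vec p k => v ≠ 0),
      ∏ x, Ψ (C x ⬝ᵥ v) ≤ (p : ℝ) ^ k * ((p : ℝ) ^ k * (337 / 512)) ^ N := by
    rw [Finset.sum_comm]
    have h1 : ∀ v ∈ Finset.univ.filter (fun v : Vec p k => v ≠ 0),
        ∑ C : X → Vec p k, ∏ x, Ψ (C x ⬝ᵥ v) ≤ ((p : ℝ) ^ k * (337 / 512)) ^ N := fun v hv => by
      have h2 := Fintype.prod_sum (fun (_ : X) (y : Vec p k) => Ψ (y ⬝ᵥ v))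
      rw [← h2, Finset.prod_const, Finset.card_univ]
      exact pow_le_pow_left₀ (Finset.sum_nonneg fun y _ => hΨ0 _) (hdot v (by simpa using hv)) _
    refine (Finset.sum_le_card_nsmul _ _ _ h1).trans ?_
    rw [nsmul_eq_mul]
    have hcard : ((Finset.univ.filter (fun v : Vec p k => v ≠ 0)).card : ℝ) ≤ (p : ℝ) ^ k := by
      have := Finset.card_filter_le (Finset.univ (α := Vec p k)) (fun v => v ≠ 0)
      rw [Finset.card_univ, Fintype.card_fun, ZMod.card, Fintype.card_fin] at this
      exact_mod_cast this
    gcongr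
  have hlow' := Finset.card_nsmul_le_sum Finset.univ _ _ (fun C _ => hlow C)
  rw [Finset.card_univ, Fintype.card_fun, Fintype.card_fun, ZMod.card, Fintype.card_fin,
    nsmul_eq_mul] at hlow'
  have h3 := hlow'.trans hup
  push_cast at h3
  rw [mul_pow, mul_left_comm] at h3
  have hpos : (0 : ℝ) < ((p : ℝ) ^ k) ^ N := by positivity
  have h4 := le_of_mul_le_mul_left h3 hpos
  have h5 : (384 : ℝ) ^ N ≤ (p : ℝ) ^ k * 337 ^ N := by
    have h6 := mul_le_mul_of_nonneg_right h4 (by positivity : (0 : ℝ) ≤ 512 ^ N)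
    rw [mul_assoc, ← mul_pow, ← mul_pow] at h6
    norm_num at h6
    exact h6
  exact absurd (by exact_mod_cast h5) (not_le.mpr hk)

/-- The dimension of the block following blocks of total dimension `s`. -/
def codeDim (p s : ℕ) : ℕ := max 1 (p ^ s / (8 * p))

theorem exists_code (s : ℕ) : ∃ C : Vec p s → Vec p (codeDim p s), (∀ x, C x ≠ 0) ∧ ∀ v, v ≠ 0 →
    Fintype.card (Vec p s) ≤ 4 * (Finset.univ.filter fun x => C x ⬝ᵥ v ≠ 0).card := by
  classical
  have hp := (Fact.out : p.Prime)
  have hcard : Fintype.card (Vec p s) = p ^ s := by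
    rw [Fintype.card_fun, ZMod.card, Fintype.card_fin]
  obtain ⟨u, hu⟩ : ∃ u : Vec p (codeDim p s), u ≠ 0 := by
    refine ⟨fun _ => 1, fun h => ?_⟩
    exact one_ne_zero (congrFun h ⟨0, lt_of_lt_of_le one_pos (le_max_left _ _)⟩)
  suffices h : ∃ C : Vec p s → Vec p (codeDim p s), ∀ v, v ≠ 0 →
      Fintype.card (Vec p s) ≤ 4 * (Finset.univ.filter fun x => C x ⬝ᵥ v ≠ 0).card by
    obtain ⟨C, hC⟩ := h
    -- Replacing zero vectors by `u` cannot decrease the number of nonzero products.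
    refine ⟨fun x => if C x = 0 then u else C x, fun x => ?_, fun v hv => (hC v hv).trans ?_⟩
    · by_cases h : C x = 0 <;> simp [h, hu]
    · refine Nat.mul_le_mul_left _ (Finset.card_le_card fun x hx => ?_)
      rw [Finset.mem_filter] at hx ⊢
      have : C x ≠ 0 := fun h0 => hx.2 (by rw [h0, zero_dotProduct])
      simpa only [if_neg this] using hx
  rcases le_total (p ^ s / (8 * p)) 1 with h | h
  · have h1 : codeDim p s = 1 := max_eq_left h
    rw [h1]
    refine ⟨fun _ _ => 1, fun v hv => ?_⟩
    have : ∀ x : Vec p s, (fun _ => 1 : Vec p 1) ⬝ᵥ v ≠ 0 := fun _ h => by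
      refine hv (funext fun i => ?_)
      rw [Subsingleton.elim i 0]
      simpa [dotProduct] using h
    rw [Finset.filter_true_of_mem fun x _ => this x, Finset.card_univ]
    omega
  · refine exists_code_of_lt _ ?_
    have h1 : codeDim p s = p ^ s / (8 * p) := max_eq_right h
    have h2 : codeDim p s * (8 * p) ≤ p ^ s := h1 ▸ Nat.div_mul_le_self _ _
    rw [hcard]
    have h3 : (p ^ codeDim p s) ^ 8 ≤ 2 ^ p ^ s := calc
      (p ^ codeDim p s) ^ 8 ≤ ((2 ^ p) ^ codeDim p s) ^ 8 := by
        gcongr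
        exact Nat.lt_two_pow_self.le
      _ = 2 ^ (codeDim p s * (8 * p)) := by rw [← pow_mul, ← pow_mul]; ring_nf
      _ ≤ _ := Nat.pow_le_pow_right (by norm_num) h2
    -- Eighth powers suffice because `2 * 337 ^ 8 < 384 ^ 8`.
    refine lt_of_pow_lt_pow_left₀ 8 (by positivity) ?_
    calc (p ^ codeDim p s * 337 ^ p ^ s) ^ 8 = (p ^ codeDim p s) ^ 8 * (337 ^ 8) ^ p ^ s := by
          rw [mul_pow, ← pow_mul 337, ← pow_mul 337, mul_comm 8]
      _ ≤ 2 ^ p ^ s * (337 ^ 8) ^ p ^ s := by gcongr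
      _ = (2 * 337 ^ 8) ^ p ^ s := (mul_pow _ _ _).symm
      _ < (384 ^ 8) ^ p ^ s := by
          refine Nat.pow_lt_pow_left (by norm_num) ?_
          exact (pow_pos hp.pos s).ne'
      _ = (384 ^ p ^ s) ^ 8 := by rw [← pow_mul, ← pow_mul, mul_comm 8]

end Codes

/-! ### Building the layer system from codes. -/

section Construction

variable {p : ℕ} [Fact p.Prime]

/-- The vectors whose first `s` coordinates vanish. -/
def tail (p n s : ℕ) : Submodule (ZMod p) (Vec p n) where
  carrier := {x | ∀ j : Fin n, j.val < s → x j = 0}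
  add_mem' := fun ha hb j hj => by simp [ha j hj, hb j hj]
  zero_mem' := fun _ _ => rfl
  smul_mem' := fun c x hx j hj => by simp [hx j hj]

/-- The inclusion of the `k` coordinates following the first `s`. -/
def blockIndex {n s k : ℕ} (h : s + k ≤ n) (b : Fin k) : Fin n := ⟨s + b, by omega⟩

theorem blockIndex_injective {n s k : ℕ} (h : s + k ≤ n) : Function.Injective (blockIndex h) :=
  fun a b hab => by
    have := congrArg Fin.val hab
    simp only [blockIndex] at this
    exact Fin.ext (by omega)

theorem mem_tail_add_iff {n s k : ℕ} (h : s + k ≤ n) {x : Vec p n} (hx : x ∈ tail p n s) :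
    x ∈ tail p n (s + k) ↔ x ∘ blockIndex h = 0 := by
  constructor
  · intro hx'
    funext b
    exact hx' _ (by simp [blockIndex])
  · intro h0 j hj
    rcases lt_or_ge j.val s with hs | hs
    · exact hx j hs
    · have := congrFun h0 ⟨j.val - s, by omega⟩
      simp only [Function.comp, blockIndex] at this
      have hj' : (⟨s + (j.val - s), by omega⟩ : Fin n) = j := Fin.ext (by simp; omega)
      rwa [hj'] at this

theorem extend_mem_tail {n s k : ℕ} (h : s + k ≤ n) (y : Vec p k) :
    Function.extend (blockIndex h) y 0 ∈ tail p n s := by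
  intro j hj
  rw [Function.extend_apply']
  · rfl
  · rintro ⟨b, rfl⟩
    simp [blockIndex] at hj

theorem extend_dotProduct {n s k : ℕ} (h : s + k ≤ n) (y : Vec p k) (v : Vec p n) :
    Function.extend (blockIndex h) y 0 ⬝ᵥ v = y ⬝ᵥ (v ∘ blockIndex h) := by
  unfold dotProduct
  refine (Fintype.sum_of_injective (blockIndex h) (blockIndex_injective h) _ _ (fun j hj => ?_)
    fun b => ?_).symm
  · rw [Function.extend_apply' _ _ _ (by simpa using hj)]
    simp
  · rw [(blockIndex_injective h).extend_apply]
    rfl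

/-- Restriction to the first `s` coordinates preserves proportions; this transfers the code distance
to `Vec p n`. -/
theorem card_filter_comp_castLE {n s : ℕ} (h : s ≤ n) (P : Vec p s → Prop) [DecidablePred P] :
    (Finset.univ.filter fun x : Vec p n => P (x ∘ Fin.castLE h)).card * Fintype.card (Vec p s) =
      Fintype.card (Vec p n) * (Finset.univ.filter P).card := by
  have hinj := Fin.castLE_injective h
  have shift : ∀ u : Vec p s, ∑ x : Vec p n, (if P (x ∘ Fin.castLE h) then 1 else 0) =
      ∑ x : Vec p n, if P (x ∘ Fin.castLE h + u) then 1 else 0 := fun u =>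
    (Fintype.sum_equiv (Equiv.addRight (Function.extend (Fin.castLE h) u 0)) _ _ fun x => by
      have : (Equiv.addRight (Function.extend (Fin.castLE h) u 0) x) ∘ Fin.castLE h =
          x ∘ Fin.castLE h + u := by
        funext j
        simp [hinj.extend_apply]
      rw [this]).symm
  rw [Finset.card_filter, Finset.card_filter, mul_comm, ← smul_eq_mul, ← Finset.card_univ,
    ← Finset.sum_const, Finset.sum_congr rfl (fun u _ => shift u), Finset.sum_comm]
  have : ∀ x : Vec p n, ∑ u : Vec p s, (if P (x ∘ Fin.castLE h + u) then 1 else 0) =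
      ∑ u : Vec p s, if P u then 1 else 0 := fun x =>
    Fintype.sum_equiv (Equiv.addLeft _) _ _ (fun _ => rfl)
  simp_rw [this]
  rw [Finset.sum_const, smul_eq_mul, Finset.card_univ]

/-- The total dimension of the first `i` blocks. -/
def blockStart (p : ℕ) : ℕ → ℕ
  | 0 => 0
  | i + 1 => blockStart p i + codeDim p (blockStart p i)

theorem blockStart_monotone (p : ℕ) : Monotone (blockStart p) :=
  monotone_nat_of_le_succ fun _ => Nat.le_add_right _ _

theorem exists_layerSystem {n M : ℕ} (hn : blockStart p M ≤ n) :
    ∃ S : LayerSystem p n M, ∀ i, S.dim i = codeDim p (blockStart p i) := by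
  classical
  choose C hC0 hC using fun s => exists_code (p := p) s
  have hle : ∀ i, i < M → blockStart p i + codeDim p (blockStart p i) ≤ n := fun i hi =>
    (blockStart_monotone p (Nat.succ_le_of_lt hi)).trans hn
  have hle' : ∀ i, i < M → blockStart p i ≤ n := fun i hi => (Nat.le_add_right _ _).trans (hle i hi)
  let ξ : ℕ → Vec p n → Vec p n := fun i x => if hi : i < M then
    Function.extend (blockIndex (hle i hi)) (C _ (x ∘ Fin.castLE (hle' i hi))) 0 else 0
  have hξ : ∀ i (hi : i < M) x, ξ i x = Function.extend (blockIndex (hle i hi))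
    (C _ (x ∘ Fin.castLE (hle' i hi))) 0 := fun i hi x => dif_pos hi
  refine ⟨{ H := fun i => tail p n (blockStart p i)
            anti := fun i j hij x hx l hl => hx l (hl.trans_le (blockStart_monotone p hij))
            top := ?_
            ξ := ξ
            dim := fun i => codeDim p (blockStart p i)
            invariant := ?_
            nonzero := ?_
            perp := ?_
            spread := ?_
            block := ?_ }, fun _ => rfl⟩
  · rw [eq_top_iff]
    exact fun x _ j hj => absurd hj (Nat.not_lt_zero _)
  · intro i hi x h hh
    rw [hξ i hi, hξ i hi]
    congr 2
    funext j
    simp [hh (Fin.castLE (hle' i hi) j) j.2]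
  · intro i hi x
    obtain ⟨b, hb⟩ := Function.ne_iff.mp (hC0 _ (x ∘ Fin.castLE (hle' i hi)))
    refine ⟨Function.extend (blockIndex (hle i hi)) (Pi.single b 1) 0, extend_mem_tail _ _, ?_⟩
    rw [hξ i hi, extend_dotProduct, Function.extend_comp (blockIndex_injective _)]
    simpa using hb
  · intro i hi x h hh
    have h' : h ∈ tail p n (blockStart p i) := fun j hj =>
      hh j (hj.trans_le (blockStart_monotone p i.le_succ))
    rw [hξ i hi, extend_dotProduct, (mem_tail_add_iff (hle i hi) h').mp hh, dotProduct_zero]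
  · intro i hi v hv hv'
    have hne : v ∘ blockIndex (hle i hi) ≠ 0 := fun h => hv' ((mem_tail_add_iff (hle i hi) hv).mpr h)
    have h1 := hC _ _ hne
    have h2 := card_filter_comp_castLE (hle' i hi)
      (fun u => C _ u ⬝ᵥ (v ∘ blockIndex (hle i hi)) ≠ 0)
    simp_rw [hξ i hi, extend_dotProduct]
    refine Nat.le_of_mul_le_mul_right ?_ (Fintype.card_pos (α := Vec p (blockStart p i)))
    rw [mul_assoc, h2]
    calc _ ≤ Fintype.card (Vec p n) * (4 * _) := Nat.mul_le_mul_left _ h1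
      _ = _ := by ring
  · intro i hi
    refine ⟨Function.ExtendByZero.linearMap (ZMod p) (blockIndex (hle i hi)), fun y hy => ?_⟩
    have h1 : Function.ExtendByZero.linearMap (ZMod p) (blockIndex (hle i hi)) y =
      Function.extend (blockIndex (hle i hi)) y 0 := rfl
    rw [h1]
    refine ⟨extend_mem_tail _ _, fun h => hy ?_⟩
    have := (mem_tail_add_iff (hle i hi) (extend_mem_tail (hle i hi) y)).mp h
    rwa [Function.extend_comp (blockIndex_injective _)] at this

end Construction

/-! ### Tower growth of the blocks. -/

section Growth

theorem twr_lt_succ (i : ℕ) : twr i < twr (i + 1) := Nat.lt_two_pow_self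

theorem twr_strictMono : StrictMono twr := strictMono_nat_of_lt_succ twr_lt_succ

variable {p : ℕ} [hp : Fact p.Prime]

theorem two_pow_le_codeDim {s : ℕ} (hs : 4 ≤ s) : 2 ^ (s - 4) ≤ codeDim p s := by
  have hp2 := hp.out.two_le
  refine le_trans ?_ (le_max_right _ _)
  rw [Nat.le_div_iff_mul_le (by omega)]
  obtain ⟨t, rfl⟩ := Nat.exists_eq_add_of_le' hs
  calc 2 ^ (t + 4 - 4) * (8 * p) = 2 ^ (t + 3) * p := by rw [Nat.add_sub_cancel]; ring
    _ ≤ p ^ (t + 3) * p := by gcongr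
    _ = p ^ (t + 4) := (pow_succ _ _).symm

theorem blockStart_add_two_pow_le {i s : ℕ} (hs : 4 ≤ s) (h : s ≤ blockStart p i) :
    s + 2 ^ (s - 4) ≤ blockStart p (i + 1) := by
  have h1 := two_pow_le_codeDim (p := p) (hs.trans h)
  have h2 : 2 ^ (s - 4) ≤ 2 ^ (blockStart p i - 4) := Nat.pow_le_pow_right two_pos (by omega)
  rw [blockStart]
  omega

theorem le_blockStart (p i : ℕ) : i ≤ blockStart p i := by
  induction i with
  | zero => exact Nat.zero_le _
  | succ i ih =>
    have : 1 ≤ codeDim p (blockStart p i) := le_max_left _ _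
    rw [blockStart]
    omega

/-- The factor `2` absorbs the loss of `4` in the exponent at each step. -/
theorem two_mul_twr_le_blockStart (i t : ℕ) : 2 * twr (t + 3) ≤ blockStart p (i + 8 + t) := by
  induction t with
  | zero =>
    -- Four blocks give dimension at least `4`; the next four give `5`, `7`, `15` and `15 + 2 ^ 11`,
    -- beyond `2 * twr 3 = 32`.
    have h4 : 4 ≤ blockStart p (i + 4) := (Nat.le_add_left 4 i).trans (le_blockStart p _)
    have h5 := blockStart_add_two_pow_le (p := p) le_rfl h4
    have h6 := blockStart_add_two_pow_le (p := p) (by norm_num) h5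
    have h7 := blockStart_add_two_pow_le (p := p) (by norm_num) h6
    have h8 := blockStart_add_two_pow_le (p := p) (by norm_num) h7
    refine le_trans ?_ h8
    norm_num [twr]
  | succ t ih =>
    have h16 : 16 ≤ twr (t + 3) := (twr_strictMono.monotone (Nat.le_add_left 3 t) : twr 3 ≤ _)
    have h := blockStart_add_two_pow_le (p := p) (by omega) ih
    have h2 : 2 ^ (twr (t + 3) + 1) ≤ 2 ^ (2 * twr (t + 3) - 4) :=
      Nat.pow_le_pow_right two_pos (by omega)
    rw [pow_succ] at h2
    have h3 : twr (t + 1 + 3) = 2 ^ twr (t + 3) := rfl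
    rw [h3]
    have h4 : i + 8 + (t + 1) = i + 8 + t + 1 := rfl
    rw [h4]
    omega

theorem twr_lt_codeDim (i t : ℕ) : twr t < codeDim p (blockStart p (i + 8 + t)) := by
  have h := two_mul_twr_le_blockStart (p := p) i t
  have h16 : 16 ≤ twr (t + 3) := (twr_strictMono.monotone (Nat.le_add_left 3 t) : twr 3 ≤ _)
  calc twr t < twr (t + 3) := twr_strictMono (by omega)
    _ < 2 ^ twr (t + 3) := Nat.lt_two_pow_self
    _ ≤ 2 ^ (blockStart p (i + 8 + t) - 4) := Nat.pow_le_pow_right two_pos (by omega)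
    _ ≤ _ := two_pow_le_codeDim (by omega)

end Growth

/-! ### Levels and weights. -/

section Levels

/-- The index of the first layer of level `l`: this level consists of `8 + wwz l` light layers
followed by a heavy one. -/
def levelStart : ℕ → ℕ
  | 0 => 0
  | l + 1 => levelStart l + (8 + wwz l) + 1

theorem levelStart_monotone : Monotone levelStart :=
  monotone_nat_of_le_succ fun l => by rw [levelStart]; omega

/-- The weight of layer `i` in a sum of `L` levels. -/
noncomputable def weight (L i : ℕ) : ℝ :=
  ∑ l ∈ Finset.range L,
    ((if i ∈ Finset.Ico (levelStart l) (levelStart l + (8 + wwz l)) then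
        1 / (4 * (L : ℝ) * (8 + wwz l)) else 0) +
      if i = levelStart l + (8 + wwz l) then 3 / (4 * (L : ℝ)) else 0)

theorem weight_term_nonneg (L i l : ℕ) :
    0 ≤ ((if i ∈ Finset.Ico (levelStart l) (levelStart l + (8 + wwz l)) then
        1 / (4 * (L : ℝ) * (8 + wwz l)) else 0) +
      if i = levelStart l + (8 + wwz l) then 3 / (4 * (L : ℝ)) else 0) := by
  split_ifs <;> positivity

theorem weight_nonneg (L i : ℕ) : 0 ≤ weight L i :=
  Finset.sum_nonneg fun l _ => weight_term_nonneg L i l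

theorem le_weight_heavy {L l : ℕ} (hl : l < L) :
    3 / (4 * (L : ℝ)) ≤ weight L (levelStart l + (8 + wwz l)) := by
  refine le_trans ?_ (Finset.single_le_sum (fun l _ => weight_term_nonneg L _ l)
    (Finset.mem_range.mpr hl))
  simp

theorem le_weight {L l i : ℕ} (hl : l < L) (h1 : levelStart l ≤ i)
    (h2 : i < levelStart (l + 1)) : 1 / (4 * (L : ℝ) * (8 + wwz l)) ≤ weight L i := by
  have hL : (0 : ℝ) < L := Nat.cast_pos.mpr (by omega)
  rcases lt_or_ge i (levelStart l + (8 + wwz l)) with h | h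
  · refine le_trans ?_ (Finset.single_le_sum (fun l _ => weight_term_nonneg L _ l)
      (Finset.mem_range.mpr hl))
    rw [if_pos (Finset.mem_Ico.mpr ⟨h1, h⟩), if_neg h.ne, add_zero]
  · have hi : i = levelStart l + (8 + wwz l) := by rw [levelStart] at h2; omega
    rw [hi]
    refine le_trans ?_ (le_weight_heavy hl)
    rw [div_le_div_iff₀ (by positivity) (by positivity)]
    have : (0 : ℝ) ≤ wwz l := Nat.cast_nonneg _
    nlinarith [mul_nonneg hL.le this]

theorem sum_weight_le_one (L : ℕ) (s : Finset ℕ) : ∑ i ∈ s, weight L i ≤ 1 := by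
  rcases Nat.eq_zero_or_pos L with rfl | hL
  · simp [weight]
  have hL' : (0 : ℝ) < L := Nat.cast_pos.mpr hL
  unfold weight
  rw [Finset.sum_comm]
  -- The light layers of a level weigh at most `1 / (4 * L)` together, its heavy layer at most `3 /
  -- (4 * L)`.
  have h : ∀ l ∈ Finset.range L, ∑ i ∈ s,
      ((if i ∈ Finset.Ico (levelStart l) (levelStart l + (8 + wwz l)) then
        1 / (4 * (L : ℝ) * (8 + wwz l)) else 0) +
      if i = levelStart l + (8 + wwz l) then 3 / (4 * (L : ℝ)) else 0) ≤ 1 / (L : ℝ) := by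
    intro l _
    rw [Finset.sum_add_distrib, ← Finset.sum_filter, Finset.sum_const, nsmul_eq_mul,
      Finset.filter_mem_eq_inter, Finset.sum_ite_eq']
    have hc : ((s ∩ Finset.Ico (levelStart l) (levelStart l + (8 + wwz l))).card : ℝ) ≤
        8 + wwz l := by
      have := Finset.card_le_card
        (Finset.inter_subset_right (s₁ := s)
          (s₂ := Finset.Ico (levelStart l) (levelStart l + (8 + wwz l))))
      rw [Nat.card_Ico, Nat.add_sub_cancel_left] at this
      exact_mod_cast this
    have h1 : ((s ∩ Finset.Ico (levelStart l) (levelStart l + (8 + wwz l))).card : ℝ) *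
        (1 / (4 * (L : ℝ) * (8 + wwz l))) ≤ 1 / (4 * L) := by
      rw [mul_one_div, div_le_div_iff₀ (by positivity) (by positivity)]
      nlinarith
    have h2 : (if levelStart l + (8 + wwz l) ∈ s then 3 / (4 * (L : ℝ)) else 0) ≤
        3 / (4 * (L : ℝ)) := by
      split_ifs
      · exact le_rfl
      · positivity
    calc _ ≤ 1 / (4 * (L : ℝ)) + 3 / (4 * L) := add_le_add h1 h2
      _ = 1 / L := by field_simp; norm_num
  refine (Finset.sum_le_card_nsmul _ _ _ h).trans ?_
  rw [Finset.card_range, nsmul_eq_mul, mul_one_div, div_self hL'.ne']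

end Levels

/-! ### Induction over levels. -/

section Main

variable {p : ℕ} [hp : Fact p.Prime]

theorem wwz_lt_codim_of_strongRegularPair {n L : ℕ} {δ : ℝ} {ε : ℕ → ℝ} (hL : 0 < L)
    (hδ : δ ≤ 1 / (20 * p * (L : ℝ) ^ 2)) (hε0 : ∀ d, 0 ≤ ε d)
    (hε : ∀ d : ℕ, ε d ≤ Real.sqrt δ / (80 * (p : ℝ) ^ 2 * ((d : ℝ) + 1)))
    (S : LayerSystem p n (levelStart L)) (hS : ∀ i, S.dim i = codeDim p (blockStart p i))
    {W₁ W₂ : Submodule (ZMod p) (Vec p n)}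
    (hW : IsStrongRegularPair (S.layerSum (weight L)) δ ε W₁ W₂) : wwz L < codim W₁ := by
  obtain ⟨h21, hreg, hen⟩ := hW
  have hp2 : (2 : ℝ) ≤ p := by exact_mod_cast hp.out.two_le
  have hL0 : (0 : ℝ) < L := Nat.cast_pos.mpr hL
  have hf := S.layerSum_mem_Icc (weight L) (weight_nonneg L) (sum_weight_le_one L _)
  set d := codim W₁ with hd
  have hsqrt : Real.sqrt δ ≤ 1 / (6 * L) := by
    refine Real.sqrt_le_iff.mpr ⟨by positivity, hδ.trans ?_⟩
    rw [div_pow, one_pow, div_le_div_iff₀ (by positivity) (by positivity)]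
    nlinarith [sq_nonneg (L : ℝ)]
  have hεd : 2 * ε d ≤ 1 / (240 * L * (p : ℝ) ^ 2 * (d + 1)) := calc
    2 * ε d ≤ 2 * (1 / (6 * L) / (80 * (p : ℝ) ^ 2 * ((d : ℝ) + 1))) := by
      have := hε d
      have h2 : Real.sqrt δ / (80 * (p : ℝ) ^ 2 * ((d : ℝ) + 1)) ≤
        1 / (6 * L) / (80 * (p : ℝ) ^ 2 * ((d : ℝ) + 1)) := by gcongr
      linarith
    _ = _ := by field_simp; norm_num
  have refine_layer : ∀ l < L, wwz l ≤ d + 1 → ∀ i, levelStart l ≤ i → i < levelStart (l + 1) →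
      W₂ ≤ S.H i → W₂ ≤ S.H (i + 1) := by
    intro l hl hwd i hi1 hi2 hWi
    refine LayerSystem.le_of_isRegularPartition
      (hi2.trans_le (levelStart_monotone (Nat.succ_le_of_lt hl))) (weight_nonneg L i) hf (hε0 d)
      hreg hWi (hεd.trans_lt ?_)
    refine lt_of_lt_of_le ?_ (div_le_div_of_nonneg_right (le_weight hl hi1 hi2) (by positivity))
    have hwd' : (wwz l : ℝ) ≤ d + 1 := by exact_mod_cast hwd
    have hd0 : (0 : ℝ) ≤ d := Nat.cast_nonneg _
    rw [div_div, div_lt_div_iff₀ (by positivity) (by positivity), one_mul, one_mul]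
    -- From `wwz l ≤ d + 1` follows `8 + wwz l ≤ 9 * (d + 1)`.
    calc 4 * (L : ℝ) * (8 + wwz l) * (4 * p) ≤ 4 * (L : ℝ) * (9 * (d + 1)) * (4 * p) := by
          gcongr
          linarith
      _ = (L : ℝ) * p * (d + 1) * 144 := by ring
      _ < (L : ℝ) * p * (d + 1) * (240 * p) := by gcongr; linarith
      _ = _ := by ring
  have refine_level : ∀ l < L, wwz l ≤ d + 1 → W₂ ≤ S.H (levelStart l) →
      ∀ t, levelStart l + t ≤ levelStart (l + 1) → W₂ ≤ S.H (levelStart l + t) := by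
    intro l hl hwd hWl t
    induction t with
    | zero => exact fun _ => hWl
    | succ t ih =>
      exact fun ht => refine_layer l hl hwd (levelStart l + t) (Nat.le_add_right _ _)
        (Nat.lt_of_succ_le ht) (ih ((Nat.le_succ _).trans ht))
  have step : ∀ l < L, wwz l ≤ d + 1 → W₂ ≤ S.H (levelStart l) →
      wwz (l + 1) < d ∧ W₂ ≤ S.H (levelStart (l + 1)) := by
    intro l hl hwd hWl
    have hi : levelStart l + (8 + wwz l) < levelStart L :=
      lt_of_lt_of_le (Nat.lt_succ_self _) (levelStart_monotone (Nat.succ_le_of_lt hl))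
    have hH : W₂ ≤ S.H (levelStart l + (8 + wwz l) + 1) :=
      refine_level l hl hwd hWl (8 + wwz l + 1) le_rfl
    refine ⟨?_, hH⟩
    by_contra hlt
    have hdim : d < S.dim (levelStart l + (8 + wwz l)) := by
      rw [hS, ← add_assoc]
      exact (not_lt.mp hlt).trans_lt (twr_lt_codeDim _ _)
    have gap := LayerSystem.energy_gap hi (weight L) h21 hH hdim
    have hw := le_weight_heavy hl
    have hinv : 1 / (p : ℝ) ≤ 1 / 2 := by gcongr
    have h1 : (3 / (4 * (L : ℝ))) ^ 2 * (1 / 2) / (4 * p) ≤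
        weight L (levelStart l + (8 + wwz l)) ^ 2 * (1 - 1 / p) / (4 * p) := by
      gcongr
      linarith
    -- The heavy weight is chosen so that its gap `9 / (128 * p * L ^ 2)` exceeds the allowed `δ`.
    have h2 : 1 / (20 * p * (L : ℝ) ^ 2) < (3 / (4 * (L : ℝ))) ^ 2 * (1 / 2) / (4 * p) := by
      rw [show (3 / (4 * (L : ℝ))) ^ 2 * (1 / 2) / (4 * p) = 9 / (128 * (p * (L : ℝ) ^ 2)) by
        field_simp; norm_num, div_lt_div_iff₀ (by positivity) (by positivity)]
      have : 0 < (p : ℝ) * (L : ℝ) ^ 2 := by positivity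
      linarith
    linarith
  -- The `+ 1` starts the induction even at `d = 0`, as `wwz 0 = 1`; the strict bound is only
  -- available after one level.
  have levels : ∀ l ≤ L, wwz l ≤ d + 1 ∧ (0 < l → wwz l < d) ∧ W₂ ≤ S.H (levelStart l) := by
    intro l
    induction l with
    | zero =>
      intro _
      refine ⟨Nat.le_add_left 1 d, fun h => absurd h (lt_irrefl _), ?_⟩
      exact le_top.trans_eq S.top.symm
    | succ l ih =>
      intro hl
      obtain ⟨h1, -, h3⟩ := ih (by omega)
      obtain ⟨h4, h5⟩ := step l hl h1 h3
      exact ⟨by omega, fun _ => h4, h5⟩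
  exact (levels L le_rfl).2.1 hL

theorem codim_anti {n : ℕ} {W₁ W₂ : Submodule (ZMod p) (Vec p n)} (h : W₂ ≤ W₁) :
    codim W₁ ≤ codim W₂ := by
  have h1 := Submodule.finrank_quotient_add_finrank W₁
  have h2 := Submodule.finrank_quotient_add_finrank W₂
  have h3 := Submodule.finrank_mono h
  unfold codim
  omega

/-- The number of levels that fit is at most of order `δ ^ (-1 / 2)`. -/
theorem exists_level_count {δ : ℝ} (hδ_pos : 0 < δ) (hδ_le : δ ≤ 1 / (20 * (p : ℝ))) :
    ∃ L : ℕ, 0 < L ∧ δ ≤ 1 / (20 * p * (L : ℝ) ^ 2) ∧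
      wwz ⌊Real.sqrt δ⁻¹ / (10 * (p : ℝ))⌋₊ ≤ wwz L := by
  have hp2 : (2 : ℝ) ≤ p := by exact_mod_cast hp.out.two_le
  set m := ⌊Real.sqrt δ⁻¹ / (10 * (p : ℝ))⌋₊ with hm
  rcases Nat.eq_zero_or_pos m with h0 | hpos
  -- When the floor is zero, one level still fits, by the assumed upper bound on `δ`.
  · exact ⟨1, one_pos, by simpa using hδ_le, by rw [h0]; decide⟩
  · refine ⟨m, hpos, ?_, le_rfl⟩
    have hm0 : (0 : ℝ) < m := Nat.cast_pos.mpr hpos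
    have h1 : (m : ℝ) ≤ Real.sqrt δ⁻¹ / (10 * (p : ℝ)) := Nat.floor_le (by positivity)
    rw [le_div_iff₀ (by positivity)] at h1
    have h2 : ((m : ℝ) * (10 * p)) ^ 2 ≤ δ⁻¹ :=
      (Real.le_sqrt (by positivity) (by positivity)).mp h1
    rw [le_div_iff₀ (by positivity)]
    have h3 : δ * ((m : ℝ) * (10 * p)) ^ 2 ≤ 1 := by
      have := mul_le_mul_of_nonneg_left h2 hδ_pos.le
      rwa [mul_inv_cancel₀ hδ_pos.ne'] at this
    refine le_trans ?_ h3
    have h4 : 20 * (p : ℝ) * (m : ℝ) ^ 2 ≤ (m * (10 * p)) ^ 2 := by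
      have : 0 < (m : ℝ) ^ 2 := by positivity
      nlinarith [mul_pos this (by linarith : (0 : ℝ) < p)]
    gcongr

end Main

end StrongReg

theorem theoremA (p : ℕ) [Fact p.Prime] (δ : ℝ) (hδ_pos : 0 < δ) (hδ_le : δ ≤ 1 / (20 * (p : ℝ)))
    (ε : ℕ → ℝ) (hε_mem : ∀ d, ε d ∈ Set.Ioo (0 : ℝ) 1)
    (hε_le : ∀ d : ℕ, ε d ≤ Real.sqrt δ / (80 * (p : ℝ) ^ 2 * ((d : ℝ) + 1))) :
    (∃ N : ℕ, ∀ n : ℕ, N ≤ n →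
      ∃ f : StrongReg.Vec p n → ℝ, (∀ x, f x ∈ Set.Icc (0 : ℝ) 1) ∧
        ∀ W₁ W₂ : Submodule (ZMod p) (StrongReg.Vec p n),
          StrongReg.IsStrongRegularPair f δ ε W₁ W₂ →
            StrongReg.wwz ⌊Real.sqrt δ⁻¹ / (10 * (p : ℝ))⌋₊ < StrongReg.codim W₁ ∧
            StrongReg.wwz ⌊Real.sqrt δ⁻¹ / (10 * (p : ℝ))⌋₊ < StrongReg.codim W₂) ∧
    (∀ C₁ C₂ : ℕ, StrongReg.AdmissibleConstants p δ ε C₁ C₂ →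
      StrongReg.wwz ⌊Real.sqrt δ⁻¹ / (10 * (p : ℝ))⌋₊ < C₁) := by
  open StrongReg in
  obtain ⟨L, hL, hδL, hwL⟩ := exists_level_count (p := p) hδ_pos hδ_le
  have main : ∀ n, blockStart p (levelStart L) ≤ n → ∃ f : Vec p n → ℝ,
      (∀ x, f x ∈ Set.Icc (0 : ℝ) 1) ∧ ∀ W₁ W₂ : Submodule (ZMod p) (Vec p n),
        IsStrongRegularPair f δ ε W₁ W₂ →
          wwz ⌊Real.sqrt δ⁻¹ / (10 * (p : ℝ))⌋₊ < codim W₁ ∧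
          wwz ⌊Real.sqrt δ⁻¹ / (10 * (p : ℝ))⌋₊ < codim W₂ := fun n hn => by
    obtain ⟨S, hS⟩ := exists_layerSystem hn
    refine ⟨S.layerSum (weight L),
      S.layerSum_mem_Icc _ (weight_nonneg L) (sum_weight_le_one L _), fun W₁ W₂ hW => ?_⟩
    have h := hwL.trans_lt
      (wwz_lt_codim_of_strongRegularPair hL hδL (fun d => (hε_mem d).1.le) hε_le S hS hW)
    exact ⟨h, h.trans_le (codim_anti hW.1)⟩
  refine ⟨⟨_, main⟩, fun C₁ C₂ hC => ?_⟩
  obtain ⟨f, hf, hfW⟩ := main _ le_rfl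
  obtain ⟨W₁, W₂, hW, h1, -⟩ := hC _ f hf
  exact (hfW W₁ W₂ hW).1.trans_le h1
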